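/- **Theorem (Restricted sum formula).** For positive integers $k_1,\dots,k_n$ with $k_1\ge 2$ let $$\zeta(k_1,\dots,k_n)=\sum_{m_1>\cdots>m_n>0}\frac{1}{m_1^{k_1}\cdots m_n^{k_n}},\qquad \zeta^t(k_1,\dots,k_n)=\sum_{\mathbf p}t^{\,n-\mathrm{dep}(\mathbf p)}\zeta(\mathbf p)\in\mathbb R[t],$$ where $\mathbf p$ runs over the $2^{n-1}$ indices $(k_1\,\square\,k_2\,\square\cdots\square\,k_n)$ obtained by replacing each $\square$ by a comma or by a plus sign, counted once for each choice, and $\mathrm{dep}(\mathbf p)$ is the number of entries of $\mathbf p$. Let $\rho_m=e^{\pi\sqrt{-1}/m}$, $\lambda=2\pi\sqrt{-1}$ and $\beta_{2l}=(2-4^l)B_{2l}$, where $B_{2l}$ are the Bernoulli numbers. Then for all positive integers $k,n,m$ with $k\ge n$, one has the following identity of polynomials in $t$ over $\mathbb C$: $$\sum_{\substack{k_1+\cdots+k_n=k\\ k_i\ge 1}}\zeta^t(2mk_1,\dots,2mk_n) =\left\{\sum_{i=1}^{n}\left[\sum_{j=0}^{k-i}\binom{k-j}{i} \sum_{\substack{n_0+\cdots+n_{m-1}=mj\\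 l_0+\cdots+l_{m-1}=m(k-j)\\ n_p,\,l_p\ge 0}} \left(\prod_{p=0}^{m-1}\frac{\beta_{2n_p}}{(2n_p)!\,(2l_p+1)!}\right) \rho_m^{\sum_{p=0}^{m-1}2p(n_p+l_p)}\right](-1)^i\binom{k-i}{k-n}t^{\,n-i}\right\}\frac{\lambda^{2km}}{4^{km}}.$$ -/

import Mathlib

open Polynomial

/-- The multiple zeta value `ζ(k₁,…,kₙ) = ∑_{m₁ > ⋯ > mₙ > 0} 1 / (m₁^k₁ ⋯ mₙ^kₙ)`
of an index `(k₁,…,kₙ)` given as a list; it is meaningful for admissible indices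
(all entries positive, the first one at least `2`), for which the series converges. -/
noncomputable def multipleZeta (k : List ℕ) : ℝ :=
  ∑' f : {f : Fin k.length → ℕ // StrictAnti f ∧ ∀ i, 0 < f i},
    ∏ i, 1 / (f.1 i : ℝ) ^ k.get i

/-- All the indices `(a □ k₁ □ ⋯ □ kₙ)`, where each `□` is either `,` or `+`,
listed once for each choice of the boxes. -/
def boxIndicesFrom : ℕ → List ℕ → List (List ℕ)
  | a, [] => [[a]]
  | a, b :: l => (boxIndicesFrom b l).map (fun p => a :: p) ++ boxIndicesFrom (a + b) l

/-- All the indices `(k₁ □ ⋯ □ kₙ)`, where each `□` is either `,` or `+`,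
listed once for each choice of the boxes. -/
def boxIndices : List ℕ → List (List ℕ)
  | [] => [[]]
  | a :: l => boxIndicesFrom a l

/-- The interpolated multiple zeta value
`ζ^t(k₁,…,kₙ) = ∑_{p = (k₁ □ ⋯ □ kₙ)} t^(n - dep p) ζ(p)`, a polynomial in `t` over `ℝ`. -/
noncomputable def interpolatedMultipleZeta (k : List ℕ) : ℝ[X] :=
  ((boxIndices k).map
    (fun p => (X : ℝ[X]) ^ (k.length - p.length) * C (multipleZeta p))).sum

/-- The compositions `k = k₁ + ⋯ + kₙ` of `k` into `n` positive parts. -/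
def compositionsOfLength (k n : ℕ) : Finset (Fin n → ℕ) :=
  (Finset.Nat.antidiagonalTuple n k).filter (fun κ => ∀ i, 1 ≤ κ i)

/-- `betaEven l` is `β_{2l} = (2 - 4^l) B_{2l}`. -/
def betaEven (l : ℕ) : ℚ := (2 - 4 ^ l) * _root_.bernoulli (2 * l)

/-- `ρ_m = exp(π √-1 / m)`. -/
noncomputable def rhoRoot (m : ℕ) : ℂ := Complex.exp ((Real.pi : ℂ) * Complex.I / (m : ℂ))

/-- `λ = 2 π √-1`. -/
noncomputable def lambdaConst : ℂ := 2 * (Real.pi : ℂ) * Complex.I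

/-! Expanding `ζ^t` and collecting equal indices reduces the claim to the sums `evenZetaSum m i k`
of `ζ(2mk₁,…,2mkᵢ)` over compositions of `k` into `i` parts: each such index arises by merging from
`(k-i).choose (n-i)` compositions into `n` parts (`sumCompositions_boxIndices`).

For fixed `i`, truncate at `N` and put `x_r = r^(-2m)`. The generating series in `k` is the
elementary symmetric function `e_i` of the `x_r X / (1 - x_r X)`. With `D = ∏ (1 - x_r X)`,
expanding `D((1-s)X) = D ∏ (1 + s x_r X / (1 - x_r X))` in `s` gives `D · F_i = (-X)^i D^(i) / i!`
(`oneSubProd_mul_compositionZetaSeries`).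

As `N → ∞`, for `m = 1` the coefficients of `D` tend to those of `sin(π√X)/(π√X)` by Euler's
product. For general `m`, multiplying the rotations `X ↦ ω^p X`, with `ω = ρ_m²` a primitive `m`-th
root of unity, gives the product for `r^(-2m)` in the variable `X^m` (`rotationProd_oneSubProd`).
Since `∑ β_{2l} X^l/(2l)!` is inverse to `∑ X^l/(2l+1)!` (`betaSeries_mul_sinhSeries`), dividing by
the limit of `D` yields the formula (`evenZetaSum_eq`). -/

/-! ### Recursive sums over compositions -/

/-- The sum of `f` over all the compositions of `k` into `n` positive parts, given as lists. -/
def sumCompositions {M : Type*} [AddCommMonoid M] : ℕ → ℕ → (List ℕ → M) → M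
  | 0, k, f => if k = 0 then f [] else 0
  | n + 1, k, f => ∑ ab ∈ Finset.HasAntidiagonal.antidiagonal k,
      if ab.1 = 0 then 0 else sumCompositions n ab.2 (fun l => f (ab.1 :: l))

theorem sum_antidiagonalTuple_succ {M : Type*} [AddCommMonoid M] (n k : ℕ)
    (f : (Fin (n + 1) → ℕ) → M) :
    ∑ ν ∈ Finset.Nat.antidiagonalTuple (n + 1) k, f ν =
      ∑ ab ∈ Finset.HasAntidiagonal.antidiagonal k, ∑ ν ∈ Finset.Nat.antidiagonalTuple n ab.2,
        f (Fin.cons ab.1 ν) := by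
  rw [Finset.sum_sigma']
  refine Finset.sum_nbij' (fun ν => ⟨(ν 0, ∑ i, ν (Fin.succ i)), Fin.tail ν⟩)
    (fun x => Fin.cons x.1.1 x.2) ?_ ?_ ?_ ?_ ?_
  · intro ν hν
    simp only [Finset.Nat.mem_antidiagonalTuple, Fin.sum_univ_succ] at hν
    simp [Finset.Nat.mem_antidiagonalTuple, hν, Fin.tail]
  · rintro ⟨⟨a, b⟩, ν⟩ h
    simp only [Finset.mem_sigma, Finset.HasAntidiagonal.mem_antidiagonal,
      Finset.Nat.mem_antidiagonalTuple] at h ⊢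
    simp [Fin.sum_univ_succ, h.1, h.2]
  · intro ν _
    simp
  · rintro ⟨⟨a, b⟩, ν⟩ h
    simp only [Finset.mem_sigma, Finset.HasAntidiagonal.mem_antidiagonal,
      Finset.Nat.mem_antidiagonalTuple] at h
    obtain ⟨_, rfl⟩ := h
    simp
  · intro ν _
    simp

theorem sum_compositionsOfLength {M : Type*} [AddCommMonoid M] (n k : ℕ) (f : List ℕ → M) :
    ∑ κ ∈ compositionsOfLength k n, f (List.ofFn κ) = sumCompositions n k f := by
  induction n generalizing k f with
  | zero =>
    rcases k with _ | k
    · simp [compositionsOfLength, sumCompositions]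
    · simp [compositionsOfLength, sumCompositions]
  | succ n ih =>
    rw [compositionsOfLength, Finset.sum_filter, sum_antidiagonalTuple_succ, sumCompositions]
    refine Finset.sum_congr rfl fun ab _ => ?_
    rw [← ih, compositionsOfLength, Finset.sum_filter]
    split_ifs with h
    · refine Finset.sum_eq_zero fun ν _ => if_neg fun hν => ?_
      simpa [h] using hν 0
    · refine Finset.sum_congr rfl fun ν _ => ?_
      have h1 : 1 ≤ ab.1 := Nat.one_le_iff_ne_zero.mpr h
      simp [Fin.forall_fin_succ, h1, List.ofFn_succ]

theorem sumCompositions_congr {M : Type*} [AddCommMonoid M] {n k : ℕ} {f g : List ℕ → M}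
    (h : ∀ l : List ℕ, l.length = n → (∀ a ∈ l, 1 ≤ a) → f l = g l) :
    sumCompositions n k f = sumCompositions n k g := by
  induction n generalizing k f g with
  | zero => simp [sumCompositions, h]
  | succ n ih =>
    rw [sumCompositions, sumCompositions]
    refine Finset.sum_congr rfl fun ab _ => ?_
    split_ifs with h0
    · rfl
    · refine ih fun l hl hl' => h _ (by simp [hl]) ?_
      simpa using ⟨Nat.one_le_iff_ne_zero.mpr h0, hl'⟩

theorem sumCompositions_add {M : Type*} [AddCommMonoid M] (n k : ℕ) (f g : List ℕ → M) :
    sumCompositions n k (fun l => f l + g l) = sumCompositions n k f + sumCompositions n k g := by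
  induction n generalizing k f g with
  | zero => simp only [sumCompositions]; split_ifs <;> simp
  | succ n ih =>
    simp only [sumCompositions, ih, ← Finset.sum_add_distrib]
    refine Finset.sum_congr rfl fun ab _ => ?_
    split_ifs <;> simp

theorem map_sumCompositions {M N : Type*} [AddCommMonoid M] [AddCommMonoid N] (φ : M →+ N)
    (n k : ℕ) (f : List ℕ → M) :
    φ (sumCompositions n k f) = sumCompositions n k (fun l => φ (f l)) := by
  induction n generalizing k f with
  | zero => simp only [sumCompositions]; split_ifs <;> simp
  | succ n ih =>
    simp only [sumCompositions, map_sum]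
    refine Finset.sum_congr rfl fun ab _ => ?_
    split_ifs <;> simp [ih]

theorem tendsto_sumCompositions {ι : Type*} {F : Filter ι} {M : Type*} [AddCommMonoid M]
    [TopologicalSpace M] [ContinuousAdd M] {n k : ℕ} {f : ι → List ℕ → M} {g : List ℕ → M}
    (h : ∀ l : List ℕ, l.length = n → (∀ a ∈ l, 1 ≤ a) →
      Filter.Tendsto (fun t => f t l) F (nhds (g l))) :
    Filter.Tendsto (fun t => sumCompositions n k (f t)) F (nhds (sumCompositions n k g)) := by
  induction n generalizing k f g with
  | zero =>
    simp only [sumCompositions]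
    split_ifs
    · exact h [] rfl (by simp)
    · exact tendsto_const_nhds
  | succ n ih =>
    simp only [sumCompositions]
    refine tendsto_finsetSum _ fun ab _ => ?_
    split_ifs with h0
    · exact tendsto_const_nhds
    · refine ih fun l hl hl' => h _ (by simp [hl]) ?_
      simpa using ⟨Nat.one_le_iff_ne_zero.mpr h0, hl'⟩

theorem sumCompositions_zero_succ {M : Type*} [AddCommMonoid M] (k : ℕ) (f : List ℕ → M) :
    sumCompositions 0 (k + 1) f = 0 := by
  simp [sumCompositions]

theorem sumCompositions_succ_zero {M : Type*} [AddCommMonoid M] (n : ℕ) (f : List ℕ → M) :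
    sumCompositions (n + 1) 0 f = 0 := by
  simp [sumCompositions]

/-- Increase the first entry of a list by `1`. -/
def succHead : List ℕ → List ℕ
  | [] => []
  | a :: l => (a + 1) :: l

/-- Split according to whether the first part is 1 or larger. This is the Pascal-type recursion
behind the induction on `k`. -/
theorem sumCompositions_succ_succ {M : Type*} [AddCommMonoid M] (n k : ℕ) (f : List ℕ → M) :
    sumCompositions (n + 1) (k + 1) f =
      sumCompositions n k (fun l => f (1 :: l)) +
        sumCompositions (n + 1) k (fun l => f (succHead l)) := by
  have h : sumCompositions n k (fun l => f (1 :: l)) =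
      ∑ ab ∈ Finset.HasAntidiagonal.antidiagonal k,
        if ab.1 = 0 then sumCompositions n ab.2 (fun l => f ((ab.1 + 1) :: l)) else 0 := by
    rw [Finset.sum_eq_single (0, k)]
    · simp
    · rintro ⟨a, b⟩ hab hne
      rw [Finset.HasAntidiagonal.mem_antidiagonal] at hab
      refine if_neg fun ha => hne ?_
      simp only at ha hab
      subst ha
      simpa using hab
    · simp
  rw [h, sumCompositions, sumCompositions, Finset.Nat.sum_antidiagonal_succ,
    ← Finset.sum_add_distrib]
  simp only [if_true, zero_add]
  refine Finset.sum_congr rfl fun ab _ => ?_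
  by_cases h0 : ab.1 = 0 <;> simp [h0, succHead]

theorem sumCompositions_eq_zero {M : Type*} [AddCommMonoid M] {n k : ℕ} (h : k < n)
    (f : List ℕ → M) : sumCompositions n k f = 0 := by
  induction k generalizing n f with
  | zero =>
    obtain ⟨n, rfl⟩ := Nat.exists_eq_succ_of_ne_zero h.ne'
    exact sumCompositions_succ_zero n f
  | succ k ih =>
    obtain ⟨n, rfl⟩ := Nat.exists_eq_succ_of_ne_zero (by omega : n ≠ 0)
    rw [sumCompositions_succ_succ, ih (by omega), ih (by omega), add_zero]

/-! ### Merging adjacent parts -/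

theorem boxIndicesFrom_succ (a : ℕ) (l : List ℕ) :
    boxIndicesFrom (a + 1) l = (boxIndicesFrom a l).map succHead := by
  induction l generalizing a with
  | nil => rfl
  | cons b l ih =>
    simp [boxIndicesFrom, add_right_comm a 1 b, ih, succHead, Function.comp_def]

theorem boxIndices_succHead (l : List ℕ) :
    boxIndices (succHead l) = (boxIndices l).map succHead := by
  cases l with
  | nil => rfl
  | cons a l => exact boxIndicesFrom_succ a l

/-- The first box is a comma, which keeps the 1, or a plus, which adds it to the next entry. An
empty tail has no such box. -/
theorem boxIndices_one_cons {l : List ℕ} (hl : l ≠ []) :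
    boxIndices (1 :: l) =
      (boxIndices l).map (fun p => 1 :: p) ++ (boxIndices l).map succHead := by
  cases l with
  | nil => exact absurd rfl hl
  | cons a l => simp [boxIndices, boxIndicesFrom, add_comm 1 a, boxIndicesFrom_succ]

theorem boxIndices_map_mul (c : ℕ) (l : List ℕ) :
    boxIndices (l.map (c * ·)) = (boxIndices l).map (List.map (c * ·)) := by
  cases l with
  | nil => rfl
  | cons a l =>
    simp only [boxIndices, List.map_cons]
    induction l generalizing a with
    | nil => rfl
    | cons b l ih =>
      simp [boxIndicesFrom, ih, ← mul_add, Function.comp_def]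

/-- Each composition of `k` into `i` parts is obtained by merging adjacent parts of
`(k - i).choose (n - i)` compositions into `n` parts. -/
theorem sumCompositions_boxIndices {M : Type*} [AddCommMonoid M] (n k : ℕ) (g : List ℕ → M) :
    sumCompositions n k (fun l => ((boxIndices l).map g).sum) =
      ∑ i ∈ Finset.range (n + 1), (k - i).choose (n - i) • sumCompositions i k g := by
  induction k generalizing n g with
  | zero =>
    cases n with
    | zero => simp [sumCompositions, boxIndices]
    | succ n =>
      rw [sumCompositions_succ_zero, Finset.sum_range_succ']
      simp [sumCompositions_succ_zero]
  | succ k ih =>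
    rcases n with _ | _ | n
    · simp [sumCompositions]
    -- One part is treated apart, because `boxIndices_one_cons` needs a nonempty tail.
    · have h : sumCompositions 1 (k + 1) (fun l => ((boxIndices l).map g).sum) =
          sumCompositions 1 (k + 1) g := by
        refine sumCompositions_congr fun l hl _ => ?_
        obtain ⟨a, rfl⟩ := List.length_eq_one_iff.mp hl
        simp [boxIndices, boxIndicesFrom]
      simp [h, Finset.sum_range_succ, sumCompositions_zero_succ]
    · have h : sumCompositions (n + 1) k (fun l => ((boxIndices (1 :: l)).map g).sum) =
          sumCompositions (n + 1) k (fun l => ((boxIndices l).map fun p => g (1 :: p)).sum) +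
          sumCompositions (n + 1) k (fun l => ((boxIndices l).map fun p => g (succHead p)).sum) := by
        rw [← sumCompositions_add]
        refine sumCompositions_congr fun l hl _ => ?_
        rw [boxIndices_one_cons (by rintro rfl; simp at hl)]
        simp [Function.comp_def]
      rw [sumCompositions_succ_succ, h]
      simp only [boxIndices_succHead, List.map_map, Function.comp_def]
      rw [ih (n + 1) (fun p => g (1 :: p)), ih (n + 1) (fun p => g (succHead p)),
        ih (n + 1 + 1) (fun p => g (succHead p)),
        Finset.sum_range_succ' (fun i => (k + 1 - i).choose _ • sumCompositions i (k + 1) g),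
        sumCompositions_zero_succ, smul_zero, add_zero]
      simp only [sumCompositions_succ_succ, smul_add, Finset.sum_add_distrib,
        Nat.add_sub_add_right]
      rw [add_assoc]
      congr 1
      rw [Finset.sum_range_succ' _ (n + 1 + 1), Finset.sum_range_succ' _ (n + 1)]
      -- Pascal's rule. When `k ≤ i`, truncated subtraction spoils it, but then there are no
      -- compositions of `k` into `i + 1` parts.
      have hterm : ∀ i ∈ Finset.range (n + 1),
          (k - i).choose (n + 1 - i) • sumCompositions (i + 1) k (fun l => g (succHead l)) =
          (k - (i + 1)).choose (n + 1 - (i + 1)) •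
              sumCompositions (i + 1) k (fun l => g (succHead l)) +
            (k - (i + 1)).choose (n + 1 + 1 - (i + 1)) •
              sumCompositions (i + 1) k (fun l => g (succHead l)) := by
        intro i hi
        rw [Finset.mem_range] at hi
        rcases lt_or_ge i k with hik | hik
        · rw [← add_smul]
          congr 1
          obtain ⟨a, rfl⟩ := Nat.exists_eq_add_of_lt hik
          obtain ⟨b, rfl⟩ := Nat.exists_eq_add_of_le (Nat.lt_succ_iff.mp hi)
          rw [show i + a + 1 - i = a + 1 by omega, show i + b + 1 - i = b + 1 by omega,
            show i + a + 1 - (i + 1) = a by omega, show i + b + 1 - (i + 1) = b by omega,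
            show i + b + 1 + 1 - (i + 1) = b + 1 by omega, Nat.choose_succ_succ]
        · simp [sumCompositions_eq_zero (Nat.lt_succ_of_le hik)]
      rw [Finset.sum_range_succ
          (fun i => (k - i).choose (n + 1 - i) • sumCompositions (i + 1) k fun l => g (succHead l)),
        Finset.sum_congr rfl hterm, Finset.sum_add_distrib, Finset.sum_range_succ _ (n + 1)]
      -- The empty composition exists only for `k = 0`, where the binomial coefficient vanishes.
      have h0 : ∀ j, k.choose (j + 1) • sumCompositions 0 k (fun l => g (succHead l)) = 0 := by
        intro j
        cases k with
        | zero => simp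
        | succ k => simp [sumCompositions_zero_succ]
      simp [h0, add_assoc]

/-! ### Truncated sums and their generating series -/

/-- The truncation `∑_{N ≥ r₁ > ⋯ > rₙ > 0} x(r₁)^k₁ ⋯ x(rₙ)^kₙ` of a multiple zeta series. -/
def truncatedZeta {R : Type*} [CommSemiring R] (x : ℕ → R) : ℕ → List ℕ → R
  | _, [] => 1
  | 0, _ :: _ => 0
  | N + 1, a :: l => truncatedZeta x N (a :: l) + x (N + 1) ^ a * truncatedZeta x N l

theorem truncatedZeta_nil {R : Type*} [CommSemiring R] (x : ℕ → R) (N : ℕ) :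
    truncatedZeta x N [] = 1 := by
  cases N <;> rfl

theorem truncatedZeta_map_mul {R : Type*} [CommSemiring R] (x : ℕ → R) (c N : ℕ) (l : List ℕ) :
    truncatedZeta x N (l.map (c * ·)) = truncatedZeta (fun r => x r ^ c) N l := by
  induction N generalizing l with
  | zero => cases l <;> rfl
  | succ N ih =>
    cases l with
    | nil => rfl
    | cons a l =>
      have h := ih (a :: l)
      rw [List.map_cons] at h
      rw [List.map_cons, truncatedZeta, truncatedZeta, h, ih, pow_mul]

theorem map_truncatedZeta {R S : Type*} [CommSemiring R] [CommSemiring S] (φ : R →+* S)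
    (x : ℕ → R) (N : ℕ) (l : List ℕ) :
    φ (truncatedZeta x N l) = truncatedZeta (fun r => φ (x r)) N l := by
  induction N generalizing l with
  | zero => cases l <;> simp [truncatedZeta]
  | succ N ih => cases l <;> simp [truncatedZeta, ih]

section GeneratingFunction

variable {R : Type*} [CommRing R]

/-- The generating function in `k` of the sums of the truncated zeta series over the
compositions of `k` into `i` parts. -/
noncomputable def compositionZetaSeries (x : ℕ → R) (N i : ℕ) : PowerSeries R :=
  PowerSeries.mk fun k => sumCompositions i k (truncatedZeta x N)

/-- The product `∏_{1 ≤ r ≤ N} (1 - x(r) X)`. -/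
noncomputable def oneSubProd (x : ℕ → R) (N : ℕ) : PowerSeries R :=
  ∏ r ∈ Finset.range N, (1 - PowerSeries.C (x (r + 1)) * PowerSeries.X)

/-- The power series `(-X)^i f^{(i)} / i!`. -/
noncomputable def signedHasseDeriv (i : ℕ) (f : PowerSeries R) : PowerSeries R :=
  PowerSeries.mk fun k => (-1) ^ i * (k.choose i : R) * PowerSeries.coeff k f

/-- The power series `y X / (1 - y X)`. -/
noncomputable def geometricTail (y : R) : PowerSeries R :=
  PowerSeries.mk fun k => if k = 0 then 0 else y ^ k

theorem one_sub_mul_geometricTail (y : R) :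
    (1 - PowerSeries.C y * PowerSeries.X) * geometricTail y =
      PowerSeries.C y * PowerSeries.X := by
  ext k
  rcases k with _ | _ | k <;>
    simp [sub_mul, mul_assoc, PowerSeries.coeff_succ_X_mul, geometricTail, pow_succ',
      PowerSeries.coeff_X]

theorem coeff_succ_mul_one_sub (f : PowerSeries R) (y : R) (k : ℕ) :
    PowerSeries.coeff (k + 1) (f * (1 - PowerSeries.C y * PowerSeries.X)) =
      PowerSeries.coeff (k + 1) f - y * PowerSeries.coeff k f := by
  rw [mul_comm, sub_mul, one_mul, mul_assoc, map_sub, PowerSeries.coeff_C_mul,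
    PowerSeries.coeff_succ_X_mul]

theorem oneSubProd_succ (x : ℕ → R) (N : ℕ) :
    oneSubProd x (N + 1) =
      oneSubProd x N * (1 - PowerSeries.C (x (N + 1)) * PowerSeries.X) :=
  Finset.prod_range_succ _ _

/-- Leibniz rule for a factor of degree one: only its zeroth and first derivatives contribute, the
latter as `-X · (-y)`. -/
theorem signedHasseDeriv_mul_one_sub (i : ℕ) (f : PowerSeries R) (y : R) :
    signedHasseDeriv (i + 1) (f * (1 - PowerSeries.C y * PowerSeries.X)) =
      (1 - PowerSeries.C y * PowerSeries.X) * signedHasseDeriv (i + 1) f +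
        PowerSeries.C y * PowerSeries.X * signedHasseDeriv i f := by
  ext k
  cases k with
  | zero => simp [signedHasseDeriv, mul_assoc]
  | succ k =>
    rw [mul_comm (1 - PowerSeries.C y * PowerSeries.X), map_add, coeff_succ_mul_one_sub,
      mul_assoc (PowerSeries.C y), PowerSeries.coeff_C_mul, PowerSeries.coeff_succ_X_mul]
    simp only [signedHasseDeriv, PowerSeries.coeff_mk, coeff_succ_mul_one_sub,
      Nat.choose_succ_succ]
    push_cast
    ring

theorem compositionZetaSeries_zero (x : ℕ → R) (N : ℕ) : compositionZetaSeries x N 0 = 1 := by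
  ext k
  simp [compositionZetaSeries, sumCompositions, truncatedZeta_nil, PowerSeries.coeff_one]

/-- Either `r₁ ≤ N`, or `r₁ = N + 1` and its exponent runs over all positive integers, which gives
the geometric tail. -/
theorem compositionZetaSeries_succ_succ (x : ℕ → R) (N i : ℕ) :
    compositionZetaSeries x (N + 1) (i + 1) =
      compositionZetaSeries x N (i + 1) +
        geometricTail (x (N + 1)) * compositionZetaSeries x N i := by
  ext k
  rw [map_add, PowerSeries.coeff_mul]
  simp only [compositionZetaSeries, geometricTail, PowerSeries.coeff_mk, sumCompositions,
    ← Finset.sum_add_distrib]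
  refine Finset.sum_congr rfl fun ab _ => ?_
  split_ifs
  · simp
  · simp only [truncatedZeta]
    rw [sumCompositions_add]
    congr 1
    exact (map_sumCompositions (AddMonoidHom.mulLeft (x (N + 1) ^ ab.1)) _ _ _).symm

theorem oneSubProd_mul_compositionZetaSeries (x : ℕ → R) (N i : ℕ) :
    oneSubProd x N * compositionZetaSeries x N i = signedHasseDeriv i (oneSubProd x N) := by
  induction N generalizing i with
  | zero =>
    ext k
    rcases i with _ | i
    · simp [compositionZetaSeries_zero, signedHasseDeriv]
    · have h : sumCompositions (i + 1) k (truncatedZeta x 0) = 0 := by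
        rw [sumCompositions]
        refine Finset.sum_eq_zero fun ab _ => ?_
        -- The zero homomorphism shows that the constant function 0 has sum 0.
        have := map_sumCompositions (0 : R →+ R) i ab.2 fun _ => 0
        simp only [AddMonoidHom.zero_apply] at this
        simp only [truncatedZeta]
        rw [← this]
        simp
      rcases k with _ | k <;>
        simp [oneSubProd, compositionZetaSeries, signedHasseDeriv, h, PowerSeries.coeff_one]
  | succ N ih =>
    rcases i with _ | i
    · ext k
      simp [compositionZetaSeries_zero, signedHasseDeriv]
    · rw [compositionZetaSeries_succ_succ, oneSubProd_succ, signedHasseDeriv_mul_one_sub,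
        ← ih, ← ih]
      linear_combination oneSubProd x N * compositionZetaSeries x N i *
        one_sub_mul_geometricTail (x (N + 1))

/-- Vieta: the truncated zeta at `(1,…,1)` is the elementary symmetric polynomial of `x(1), …,
x(N)`. -/
theorem coeff_oneSubProd (x : ℕ → R) (N l : ℕ) :
    PowerSeries.coeff l (oneSubProd x N) = (-1) ^ l * truncatedZeta x N (List.replicate l 1) := by
  induction N generalizing l with
  | zero =>
    cases l <;> simp [oneSubProd, truncatedZeta, PowerSeries.coeff_one, List.replicate_succ]
  | succ N ih =>
    cases l with
    | zero =>
      have := ih 0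
      simp only [PowerSeries.coeff_zero_eq_constantCoeff, List.replicate_zero,
        truncatedZeta_nil] at this
      simp [oneSubProd_succ, truncatedZeta_nil, this]
    | succ l =>
      rw [oneSubProd_succ, coeff_succ_mul_one_sub, ih, ih, List.replicate_succ, truncatedZeta]
      ring

end GeneratingFunction

/-! ### Convergence of the truncations -/

/-- The strictly decreasing `d`-tuples with entries in `{1, …, N}`. -/
def strictAntiTuples (N d : ℕ) : Finset (Fin d → ℕ) :=
  {f ∈ Fintype.piFinset fun _ => Finset.Icc 1 N | StrictAnti f}

theorem mem_strictAntiTuples {N d : ℕ} {f : Fin d → ℕ} :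
    f ∈ strictAntiTuples N d ↔ (∀ i, 1 ≤ f i ∧ f i ≤ N) ∧ StrictAnti f := by
  simp [strictAntiTuples]

theorem strictAntiTuples_zero_right (N : ℕ) : strictAntiTuples N 0 = Finset.univ :=
  Finset.eq_univ_iff_forall.mpr fun _ =>
    mem_strictAntiTuples.mpr ⟨fun i => i.elim0, fun i => i.elim0⟩

theorem strictAntiTuples_succ_succ (N d : ℕ) :
    strictAntiTuples (N + 1) (d + 1) =
      strictAntiTuples N (d + 1) ∪
        (strictAntiTuples N d).image (Fin.cons (α := fun _ => ℕ) (N + 1)) := by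
  ext f
  simp only [Finset.mem_union, Finset.mem_image, mem_strictAntiTuples]
  constructor
  · rintro ⟨h, hf⟩
    rcases (h 0).2.lt_or_eq with h0 | h0
    · refine Or.inl ⟨fun i => ⟨(h i).1, ?_⟩, hf⟩
      have := hf.antitone (Fin.zero_le i)
      omega
    · refine Or.inr ⟨Fin.tail f, ⟨fun i => ⟨(h i.succ).1, ?_⟩, fun i j hij =>
        hf (Fin.succ_lt_succ_iff.mpr hij)⟩, ?_⟩
      · have := hf (Fin.succ_pos i)
        simp only [Fin.tail]
        omega
      · rw [← h0]
        exact Fin.cons_self_tail f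
  · rintro (⟨h, hf⟩ | ⟨g, ⟨h, hg⟩, rfl⟩)
    · exact ⟨fun i => ⟨(h i).1, (h i).2.trans (Nat.le_succ N)⟩, hf⟩
    · refine ⟨fun i => ?_, fun i j hij => ?_⟩
      · refine Fin.cases (by simp) (fun i => ?_) i
        simpa using ⟨(h i).1, (h i).2.trans (Nat.le_succ N)⟩
      · induction j using Fin.cases with
        | zero => exact absurd hij (Fin.not_lt_zero i)
        | succ j =>
          induction i using Fin.cases with
          | zero => simpa using Nat.lt_succ_of_le (h j).2
          | succ i => simpa using hg (Fin.succ_lt_succ_iff.mp hij)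

theorem sum_strictAntiTuples_succ_succ {M : Type*} [AddCommMonoid M] (N d : ℕ)
    (F : (Fin (d + 1) → ℕ) → M) :
    ∑ f ∈ strictAntiTuples (N + 1) (d + 1), F f =
      ∑ f ∈ strictAntiTuples N (d + 1), F f +
        ∑ f ∈ strictAntiTuples N d, F (Fin.cons (N + 1) f) := by
  rw [strictAntiTuples_succ_succ, Finset.sum_union, Finset.sum_image]
  · exact fun f _ g _ h => Fin.cons_right_injective _ h
  · rw [Finset.disjoint_left]
    intro f hf hf'
    obtain ⟨g, _, rfl⟩ := Finset.mem_image.mp hf'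
    simpa using ((mem_strictAntiTuples.mp hf).1 0).2

theorem truncatedZeta_eq_sum {R : Type*} [CommSemiring R] (x : ℕ → R) (N : ℕ) (l : List ℕ) :
    truncatedZeta x N l = ∑ f ∈ strictAntiTuples N l.length, ∏ i, x (f i) ^ l.get i := by
  induction N generalizing l with
  | zero =>
    cases l with
    | nil =>
      simp [truncatedZeta, strictAntiTuples_zero_right]
    | cons a l =>
      rw [truncatedZeta]
      refine (Finset.sum_eq_zero fun f hf => ?_).symm
      have := (mem_strictAntiTuples.mp hf).1 ⟨0, by simp⟩
      omega
  | succ N ih =>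
    cases l with
    | nil =>
      simp [truncatedZeta, strictAntiTuples_zero_right]
    | cons a l =>
      rw [truncatedZeta, ih, ih]
      refine Eq.trans ?_ (sum_strictAntiTuples_succ_succ N l.length
        fun f => ∏ i, x (f i) ^ (a :: l).get i).symm
      congr 1
      rw [Finset.mul_sum]
      refine Finset.sum_congr rfl fun f _ => ?_
      rw [Fin.prod_univ_succ]
      rfl

theorem sum_inv_sq_le (N : ℕ) : ∑ r ∈ Finset.Icc 1 N, (1 / (r : ℝ)) ^ 2 ≤ ∑' r : ℕ, 1 / (r : ℝ) ^ 2 := by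
  simp only [one_div, inv_pow]
  exact (Real.summable_nat_pow_inv.mpr one_lt_two).sum_le_tsum _ fun _ _ => by positivity

/-- Dropping the ordering and lowering every exponent to 2 turns the sum into a power of a single
sum, so the bound is uniform in `N`. -/
theorem truncatedZeta_le {l : List ℕ} (hl : ∀ a ∈ l, 2 ≤ a) (N : ℕ) :
    truncatedZeta (fun r => 1 / (r : ℝ)) N l ≤ (∑' r : ℕ, 1 / (r : ℝ) ^ 2) ^ l.length := by
  rw [truncatedZeta_eq_sum]
  calc ∑ f ∈ strictAntiTuples N l.length, ∏ i, (1 / (f i : ℝ)) ^ l.get i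
      ≤ ∑ f ∈ Fintype.piFinset fun _ : Fin l.length => Finset.Icc 1 N,
          ∏ i, (1 / (f i : ℝ)) ^ l.get i :=
        Finset.sum_le_sum_of_subset_of_nonneg (Finset.filter_subset _ _)
          fun _ _ _ => Finset.prod_nonneg fun _ _ => by positivity
    _ ≤ ∑ f ∈ Fintype.piFinset fun _ : Fin l.length => Finset.Icc 1 N,
          ∏ i, (1 / (f i : ℝ)) ^ 2 := by
        refine Finset.sum_le_sum fun f hf => Finset.prod_le_prod (fun _ _ => by positivity) ?_
        intro i _
        have h1 : 1 ≤ f i := (Finset.mem_Icc.mp (Fintype.mem_piFinset.mp hf i)).1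
        refine pow_le_pow_of_le_one (by positivity) ?_ (hl _ (List.get_mem l i))
        rw [div_le_one (by positivity)]
        exact_mod_cast h1
    _ = (∑ r ∈ Finset.Icc 1 N, (1 / (r : ℝ)) ^ 2) ^ l.length := by
        rw [← Finset.prod_univ_sum (fun _ => Finset.Icc 1 N) fun _ r => (1 / (r : ℝ)) ^ 2]
        simp
    _ ≤ _ := pow_le_pow_left₀ (Finset.sum_nonneg fun _ _ => by positivity) (sum_inv_sq_le N) _

theorem tendsto_truncatedZeta {l : List ℕ} (hl : ∀ a ∈ l, 2 ≤ a) :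
    Filter.Tendsto (fun N => truncatedZeta (fun r => 1 / (r : ℝ)) N l) Filter.atTop
      (nhds (multipleZeta l)) := by
  set T := {f : Fin l.length → ℕ // StrictAnti f ∧ ∀ i, 0 < f i}
  let F : T → ℝ := fun f => ∏ i, 1 / (f.1 i : ℝ) ^ l.get i
  let s : ℕ → Finset T := fun N => (strictAntiTuples N l.length).subtype _
  have hs : ∀ N, ∑ f ∈ s N, F f = truncatedZeta (fun r => 1 / (r : ℝ)) N l := by
    intro N
    rw [truncatedZeta_eq_sum]
    have h := Finset.sum_subtype_of_mem (p := fun f : Fin l.length → ℕ =>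
      StrictAnti f ∧ ∀ i, 0 < f i) (s := strictAntiTuples N l.length)
      (fun f => ∏ i, (1 / (f i : ℝ)) ^ l.get i) fun f hf => ?_
    · rw [← h]
      simp only [F, s, one_div, inv_pow]
      congr!
    · rw [mem_strictAntiTuples] at hf
      exact ⟨hf.2, fun i => (hf.1 i).1⟩
  have hs_mem : ∀ N (f : T), f ∈ s N ↔ f.1 ∈ strictAntiTuples N l.length :=
    fun N f => Finset.mem_subtype
  have hmono : Monotone s := by
    intro N M hNM f hf
    rw [hs_mem, mem_strictAntiTuples] at hf ⊢
    exact ⟨fun i => ⟨(hf.1 i).1, (hf.1 i).2.trans hNM⟩, hf.2⟩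
  have hmem : ∀ f : T, ∃ N, f ∈ s N := by
    intro f
    -- The sum of the entries bounds each of them.
    refine ⟨∑ i, f.1 i, ?_⟩
    rw [hs_mem, mem_strictAntiTuples]
    exact ⟨fun i => ⟨f.2.2 i, Finset.single_le_sum (f := f.1) (fun _ _ => Nat.zero_le _)
      (Finset.mem_univ i)⟩, f.2.1⟩
  have htop : Filter.Tendsto s Filter.atTop Filter.atTop :=
    Filter.tendsto_atTop_finset_of_monotone hmono hmem
  have hF : ∀ f, 0 ≤ F f := fun f => Finset.prod_nonneg fun _ _ => by positivity
  -- The truncations are partial sums along an exhausting family, so their uniform bound gives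
  -- summability of the nonnegative terms. Without it the `tsum` would default to 0.
  have hsum : Summable F := by
    refine summable_of_sum_le hF (c := (∑' r : ℕ, 1 / (r : ℝ) ^ 2) ^ l.length) fun u => ?_
    obtain ⟨N, hN⟩ := (htop.eventually (Filter.eventually_ge_atTop u)).exists
    exact (Finset.sum_le_sum_of_subset_of_nonneg hN fun f _ _ => hF f).trans
      ((hs N).le.trans (truncatedZeta_le hl N))
  refine (hsum.hasSum.comp htop).congr hs

/-! ### Euler's evaluation of ζ(2,…,2) -/

theorem eq_of_hasSum_pow_mul {c d : ℕ → ℂ} {f : ℂ → ℂ}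
    (hc : ∀ w, HasSum (fun n => w ^ n * c n) (f w))
    (hd : ∀ w, HasSum (fun n => w ^ n * d n) (f w)) : c = d := by
  have h : ∀ {c : ℕ → ℂ}, (∀ w, HasSum (fun n => w ^ n * c n) (f w)) →
      HasFPowerSeriesAt f (FormalMultilinearSeries.ofScalars ℂ c) 0 := fun h =>
    hasFPowerSeriesAt_iff.mpr (Filter.Eventually.of_forall fun w => by
      simpa [FormalMultilinearSeries.coeff_ofScalars] using h w)
  have heq := (h hc).eq_formalMultilinearSeries (h hd)
  funext n
  simpa [FormalMultilinearSeries.coeff_ofScalars] using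
    congrArg (fun p : FormalMultilinearSeries ℂ ℂ ℂ => p.coeff n) heq

/-- The sequence `1 / r²`. -/
noncomputable def invSq (r : ℕ) : ℝ := (1 / (r : ℝ)) ^ 2

theorem truncatedZeta_nonneg {x : ℕ → ℝ} (hx : ∀ r, 0 ≤ x r) (N : ℕ) (l : List ℕ) :
    0 ≤ truncatedZeta x N l := by
  rw [truncatedZeta_eq_sum]
  exact Finset.sum_nonneg fun _ _ => Finset.prod_nonneg fun _ _ => pow_nonneg (hx _) _

theorem hasSum_truncatedZeta_replicate {R : Type*} [CommRing R] [TopologicalSpace R]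
    [IsTopologicalRing R] (x : ℕ → R) (w : R) (N : ℕ) :
    HasSum (fun l => w ^ l * truncatedZeta x N (List.replicate l 1))
      (∏ r ∈ Finset.range N, (1 + w * x (r + 1))) := by
  induction N with
  | zero =>
    convert! hasSum_ite_eq (α := R) (0 : ℕ) 1 using 1
    funext l
    cases l <;> simp [truncatedZeta, List.replicate_succ]
  | succ N ih =>
    rw [Finset.prod_range_succ, mul_add, mul_one]
    have h : (fun l => w ^ l * truncatedZeta x (N + 1) (List.replicate l 1)) = fun l =>
        w ^ l * truncatedZeta x N (List.replicate l 1) +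
          (match l with
          | 0 => 0
          | l + 1 => w ^ l * truncatedZeta x N (List.replicate l 1) * (w * x (N + 1))) := by
      funext l
      cases l with
      | zero => simp [truncatedZeta_nil]
      | succ l =>
        simp only [List.replicate_succ, truncatedZeta]
        ring
    rw [h]
    refine ih.add ?_
    have h2 := ih.mul_right (w * x (N + 1))
    have h3 := hasSum_nat_add_iff (f := fun l : ℕ => (match l with
          | 0 => 0
          | l + 1 => w ^ l * truncatedZeta x N (List.replicate l 1) * (w * x (N + 1))))
      (g := (∏ r ∈ Finset.range N, (1 + w * x (r + 1))) * (w * x (N + 1))) 1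
    simpa using h3.mp h2

theorem prod_one_add_mul_invSq_le {t : ℝ} (ht : 0 ≤ t) (N : ℕ) :
    ∏ r ∈ Finset.range N, (1 + t * invSq (r + 1)) ≤
      Real.exp (t * ∑' r : ℕ, 1 / (r : ℝ) ^ 2) := by
  calc ∏ r ∈ Finset.range N, (1 + t * invSq (r + 1))
      ≤ ∏ r ∈ Finset.range N, Real.exp (t * invSq (r + 1)) := by
        refine Finset.prod_le_prod (fun r _ => ?_) fun r _ => ?_
        · unfold invSq; positivity
        · rw [add_comm]; exact Real.add_one_le_exp _
    _ = Real.exp (t * ∑ r ∈ Finset.Icc 1 N, (1 / (r : ℝ)) ^ 2) := by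
        rw [← Real.exp_sum, ← Finset.mul_sum, Finset.range_eq_Ico,
          Finset.sum_Ico_add' invSq 0 N 1, zero_add]
        rfl
    _ ≤ _ := Real.exp_le_exp.mpr (mul_le_mul_of_nonneg_left (sum_inv_sq_le N) ht)

theorem pow_mul_truncatedZeta_invSq_le {t : ℝ} (ht : 0 ≤ t) (N l : ℕ) :
    t ^ l * truncatedZeta invSq N (List.replicate l 1) ≤
      Real.exp (t * ∑' r : ℕ, 1 / (r : ℝ) ^ 2) :=
  (le_hasSum (hasSum_truncatedZeta_replicate invSq t N) l fun _ _ =>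
    mul_nonneg (pow_nonneg ht _) (truncatedZeta_nonneg (fun _ => sq_nonneg _) _ _)).trans
    (prod_one_add_mul_invSq_le ht N)

theorem tendsto_truncatedZeta_invSq (l : ℕ) :
    Filter.Tendsto (fun N => truncatedZeta invSq N (List.replicate l 1)) Filter.atTop
      (nhds (multipleZeta (List.replicate l 2))) := by
  have h := tendsto_truncatedZeta (l := List.replicate l 2)
    fun a ha => (List.eq_of_mem_replicate ha).ge
  have h2 : List.replicate l 2 = (List.replicate l 1).map (2 * ·) := by simp
  refine h.congr fun N => ?_
  rw [h2, truncatedZeta_map_mul]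
  rfl

/-- Dominated convergence interchanges the limit in `N` with the sum over `l`, identifying the
generating function of `ζ(2,…,2)` with the infinite product. -/
theorem hasSum_multipleZeta_replicate_two {t : ℂ} :
    HasSum (fun l => t ^ l * (multipleZeta (List.replicate l 2) : ℂ))
      (∑' l, t ^ l * (multipleZeta (List.replicate l 2) : ℂ)) ∧
    Filter.Tendsto (fun N => ∏ r ∈ Finset.range N, (1 + t * (invSq (r + 1) : ℂ))) Filter.atTop
      (nhds (∑' l, t ^ l * (multipleZeta (List.replicate l 2) : ℂ))) := by
  -- Bounding at `2‖t‖` instead of `‖t‖` gains a factor `2^(-l)`, which makes the majorant summable.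
  set K := Real.exp (2 * ‖t‖ * ∑' r : ℕ, 1 / (r : ℝ) ^ 2)
  have hbound : ∀ N l, ‖t‖ ^ l * truncatedZeta invSq N (List.replicate l 1) ≤ K * (1 / 2) ^ l := by
    intro N l
    have := pow_mul_truncatedZeta_invSq_le (t := 2 * ‖t‖) (by positivity) N l
    rw [mul_pow, mul_assoc] at this
    rw [one_div, inv_pow, ← div_eq_mul_inv, le_div_iff₀ (by positivity), mul_comm]
    exact this
  have hsummable : Summable fun l : ℕ => K * (1 / 2 : ℝ) ^ l :=
    summable_geometric_two.mul_left K
  have hlim : ∀ l, Filter.Tendsto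
      (fun N => t ^ l * ((truncatedZeta invSq N (List.replicate l 1) : ℝ) : ℂ)) Filter.atTop
      (nhds (t ^ l * (multipleZeta (List.replicate l 2) : ℂ))) := fun l =>
    ((Complex.continuous_ofReal.tendsto _).comp (tendsto_truncatedZeta_invSq l)).const_mul _
  have hnorm : ∀ N l, ‖t ^ l * ((truncatedZeta invSq N (List.replicate l 1) : ℝ) : ℂ)‖ ≤
      K * (1 / 2) ^ l := by
    intro N l
    rw [norm_mul, norm_pow, Complex.norm_real, Real.norm_eq_abs,
      abs_of_nonneg (truncatedZeta_nonneg (x := invSq) (fun _ => sq_nonneg _) _ _)]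
    exact hbound N l
  constructor
  · refine (hsummable.of_norm_bounded fun l => ?_).hasSum
    exact le_of_tendsto (hlim l).norm (Filter.Eventually.of_forall fun N => hnorm N l)
  · have h := tendsto_tsum_of_dominated_convergence hsummable hlim
      (Filter.Eventually.of_forall hnorm)
    refine h.congr fun N => ?_
    rw [← (hasSum_truncatedZeta_replicate (fun r => (invSq r : ℂ)) t N).tsum_eq]
    refine tsum_congr fun l => ?_
    congr 1
    exact map_truncatedZeta Complex.ofRealHom invSq N _

/-- Euler's evaluation `ζ(2,…,2) = π^(2l) / (2l+1)!`. -/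
theorem multipleZeta_replicate_two (l : ℕ) :
    (multipleZeta (List.replicate l 2) : ℂ) =
      (Real.pi : ℂ) ^ (2 * l) / (Nat.factorial (2 * l + 1) : ℂ) := by
  have hpi : (Real.pi : ℂ) ≠ 0 := Complex.ofReal_ne_zero.mpr Real.pi_ne_zero
  have h0 : ∀ w : ℂ, HasSum
      (fun l => w ^ l * ((Real.pi : ℂ) ^ (2 * l) / (Nat.factorial (2 * l + 1) : ℂ)))
      (∑' l, w ^ l * (multipleZeta (List.replicate l 2) : ℂ)) := by
    intro w
    -- With `w = -z²` the factors become `1 - z²/r²`, as in the sine product. The value `z = 0` is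
    -- separate because of the division by `πz`.
    obtain ⟨z, rfl⟩ : ∃ z : ℂ, w = -z ^ 2 := by
      obtain ⟨z, hz⟩ := IsAlgClosed.exists_pow_nat_eq (-w) zero_lt_two
      exact ⟨z, by rw [hz, neg_neg]⟩
    rcases eq_or_ne z 0 with rfl | hz
    · have h1 := (hasSum_multipleZeta_replicate_two (t := -0 ^ 2)).1
      have h2 : (∑' l, (-0 ^ 2 : ℂ) ^ l * (multipleZeta (List.replicate l 2) : ℂ)) = 1 := by
        refine tendsto_nhds_unique (hasSum_multipleZeta_replicate_two (t := -0 ^ 2)).2 ?_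
        simp
      rw [h2]
      convert! hasSum_ite_eq (α := ℂ) (0 : ℕ) 1 using 1
      funext l
      cases l <;> simp
    · have hs := (Complex.hasSum_sin (Real.pi * z)).div_const (Real.pi * z)
      have hlim := tendsto_nhds_unique (hasSum_multipleZeta_replicate_two (t := -z ^ 2)).2
        (((Complex.tendsto_euler_sin_prod z).div_const (Real.pi * z)).congr fun N => by
          rw [mul_div_cancel_left₀ _ (mul_ne_zero hpi hz)]
          refine Finset.prod_congr rfl fun r _ => ?_
          simp only [invSq]
          push_cast
          rw [one_div, inv_pow, neg_mul, ← sub_eq_add_neg, div_eq_mul_inv])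
      rw [hlim]
      convert! hs using 1
      funext l
      rw [neg_pow, ← pow_mul, eq_div_iff (mul_ne_zero hpi hz)]
      ring
  exact congrFun (eq_of_hasSum_pow_mul (fun w => (hasSum_multipleZeta_replicate_two (t := w)).1)
    h0) l

/-- The limit is the coefficient of `sin(π√X)/(π√X)`, that is, of `sinhSeries` rescaled by `-π²`. -/
theorem tendsto_coeff_oneSubProd_invSq (l : ℕ) :
    Filter.Tendsto (fun N => PowerSeries.coeff l (oneSubProd (fun r => (invSq r : ℂ)) N))
      Filter.atTop
      (nhds ((-(Real.pi : ℂ) ^ 2) ^ l / (Nat.factorial (2 * l + 1) : ℂ))) := by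
  have h := ((Complex.continuous_ofReal.tendsto _).comp
    (tendsto_truncatedZeta_invSq l)).const_mul ((-1 : ℂ) ^ l)
  rw [multipleZeta_replicate_two] at h
  have he : (-(Real.pi : ℂ) ^ 2) ^ l / (Nat.factorial (2 * l + 1) : ℂ) =
      (-1) ^ l * ((Real.pi : ℂ) ^ (2 * l) / (Nat.factorial (2 * l + 1) : ℂ)) := by
    rw [neg_pow, pow_mul]
    ring
  rw [he]
  refine h.congr fun N => ?_
  rw [coeff_oneSubProd]
  congr 1
  exact map_truncatedZeta Complex.ofRealHom invSq N _

/-! ### The series of β and its inverse -/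

/-- The power series `∑ β_{2l} X^l / (2l)!`. -/
noncomputable def betaSeries : PowerSeries ℂ :=
  PowerSeries.mk fun l => (betaEven l : ℂ) / (Nat.factorial (2 * l) : ℂ)

/-- The power series `∑ X^l / (2l+1)!`. -/
noncomputable def sinhSeries : PowerSeries ℂ :=
  PowerSeries.mk fun l => 1 / (Nat.factorial (2 * l + 1) : ℂ)

/-- Passing to `X²` avoids square roots. The odd coefficients on the right vanish: at 1 because of
`2 - 2^n`, beyond 1 because the Bernoulli numbers do. -/
theorem expand_betaSeries :
    PowerSeries.expand 2 two_ne_zero betaSeries =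
      2 * bernoulliPowerSeries ℂ - PowerSeries.rescale 2 (bernoulliPowerSeries ℂ) := by
  ext n
  have hn : PowerSeries.coeff n
      (2 * bernoulliPowerSeries ℂ - PowerSeries.rescale 2 (bernoulliPowerSeries ℂ)) =
      (2 - 2 ^ n) * ((_root_.bernoulli n : ℂ) / (Nat.factorial n : ℂ)) := by
    rw [map_sub, PowerSeries.coeff_rescale, two_mul, map_add]
    simp [bernoulliPowerSeries]
    ring
  rw [hn]
  rcases Nat.even_or_odd n with h | h
  · obtain ⟨l, rfl⟩ := h.two_dvd
    rw [PowerSeries.coeff_expand_mul]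
    simp only [betaSeries, betaEven, PowerSeries.coeff_mk, pow_mul]
    push_cast
    norm_num
    ring
  · rw [PowerSeries.coeff_expand_of_not_dvd _ _ _ (by
      rw [← even_iff_two_dvd]; exact Nat.not_even_iff_odd.mpr h)]
    rcases Nat.eq_or_lt_of_le h.pos with h1 | h1
    · simp [← h1]
    · rw [_root_.bernoulli_eq_zero_of_odd h (by omega)]
      simp

theorem exp_sub_exp_neg_eq :
    PowerSeries.exp ℂ - PowerSeries.evalNegHom (PowerSeries.exp ℂ) =
      2 * PowerSeries.X * PowerSeries.expand 2 two_ne_zero sinhSeries := by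
  ext n
  rw [PowerSeries.evalNegHom, map_sub, PowerSeries.coeff_rescale, mul_assoc, two_mul, map_add]
  cases n with
  | zero => simp
  | succ n =>
    rw [PowerSeries.coeff_succ_X_mul]
    rcases Nat.even_or_odd n with h | h
    · obtain ⟨l, rfl⟩ := h.two_dvd
      rw [PowerSeries.coeff_expand_mul]
      simp [sinhSeries, pow_succ, PowerSeries.coeff_exp]
    · rw [PowerSeries.coeff_expand_of_not_dvd _ _ _ (by
        rw [← even_iff_two_dvd]; exact Nat.not_even_iff_odd.mpr h)]
      simp [h.add_one.neg_one_pow]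

/-- In the variable `X²` the two factors are `X / sinh X` and `sinh X / X`, since `2X/(e^X - 1) -
2X/(e^(2X) - 1) = 2X/(e^X - e^(-X))`. -/
theorem betaSeries_mul_sinhSeries : betaSeries * sinhSeries = 1 := by
  set B := bernoulliPowerSeries ℂ with hBdef
  set e := PowerSeries.exp ℂ
  set e' := PowerSeries.evalNegHom e
  have hB : B * (e - 1) = PowerSeries.X := bernoulliPowerSeries_mul_exp_sub_one ℂ
  have he : e * e' = 1 := PowerSeries.exp_mul_exp_neg_eq_one
  have he2 : PowerSeries.rescale 2 e = e ^ 2 := by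
    have := PowerSeries.exp_pow_eq_rescale_exp (A := ℂ) 2
    simpa using this.symm
  have hB2 : PowerSeries.rescale 2 B * (e ^ 2 - 1) = 2 * PowerSeries.X := by
    have := congrArg (PowerSeries.rescale (2 : ℂ)) hB
    rw [map_mul, map_sub, map_one, he2, PowerSeries.rescale_X] at this
    rwa [show PowerSeries.C (2 : ℂ) = 2 from map_ofNat _ 2] at this
  have hH : PowerSeries.expand 2 two_ne_zero betaSeries *
      (2 * PowerSeries.X * PowerSeries.expand 2 two_ne_zero sinhSeries) =
      2 * PowerSeries.X := by
    rw [← exp_sub_exp_neg_eq, expand_betaSeries]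
    change (2 * B - PowerSeries.rescale 2 B) * (e - e') = 2 * PowerSeries.X
    linear_combination (2 * (e + 1) * e') * hB - e' * hB2 +
      (2 * PowerSeries.X - (2 * B - PowerSeries.rescale 2 B) * e) * he
  have h1 : PowerSeries.expand 2 two_ne_zero (betaSeries * sinhSeries) = 1 := by
    have h2X : (2 * PowerSeries.X : PowerSeries ℂ) ≠ 0 := by
      rw [← show PowerSeries.C (2 : ℂ) = 2 from map_ofNat _ 2]
      refine mul_ne_zero (fun h => two_ne_zero (α := ℂ) ?_) PowerSeries.X_ne_zero
      simpa using congrArg PowerSeries.constantCoeff h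
    refine mul_left_cancel₀ h2X ?_
    rw [map_mul]
    linear_combination hH
  ext n
  rw [← PowerSeries.coeff_expand_mul 2 two_ne_zero, h1]
  simp [PowerSeries.coeff_one]

/-! ### Products over rotations by roots of unity -/

/-- The product of the series `f(ω^p X)` over `0 ≤ p < m`. -/
noncomputable def rotationProd (ω : ℂ) (m : ℕ) (f : PowerSeries ℂ) : PowerSeries ℂ :=
  ∏ p : Fin m, PowerSeries.rescale (ω ^ (p : ℕ)) f

theorem rotationProd_mul (ω : ℂ) (m : ℕ) (f g : PowerSeries ℂ) :
    rotationProd ω m (f * g) = rotationProd ω m f * rotationProd ω m g := by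
  simp [rotationProd, Finset.prod_mul_distrib]

theorem rotationProd_one (ω : ℂ) (m : ℕ) : rotationProd ω m 1 = 1 := by
  simp [rotationProd]

theorem rotationProd_prod (ω : ℂ) (m : ℕ) {ι : Type*} (s : Finset ι) (f : ι → PowerSeries ℂ) :
    rotationProd ω m (∏ r ∈ s, f r) = ∏ r ∈ s, rotationProd ω m (f r) := by
  simp only [rotationProd, map_prod]
  exact Finset.prod_comm

theorem coeff_prod_fin {R : Type*} [CommSemiring R] (m n : ℕ) (f : Fin m → PowerSeries R) :
    PowerSeries.coeff n (∏ p, f p) =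
      ∑ ν ∈ Finset.Nat.antidiagonalTuple m n, ∏ p, PowerSeries.coeff (ν p) (f p) := by
  induction m generalizing n with
  | zero => cases n <;> simp [PowerSeries.coeff_one]
  | succ m ih =>
    rw [Fin.prod_univ_succ, PowerSeries.coeff_mul, sum_antidiagonalTuple_succ]
    refine Finset.sum_congr rfl fun ab _ => ?_
    rw [ih, Finset.mul_sum]
    refine Finset.sum_congr rfl fun ν _ => ?_
    simp [Fin.prod_univ_succ]

theorem coeff_rotationProd (ω : ℂ) (m n : ℕ) (f : PowerSeries ℂ) :
    PowerSeries.coeff n (rotationProd ω m f) =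
      ∑ ν ∈ Finset.Nat.antidiagonalTuple m n,
        (∏ p, PowerSeries.coeff (ν p) f) * ω ^ ∑ p : Fin m, (p : ℕ) * ν p := by
  rw [rotationProd, coeff_prod_fin]
  refine Finset.sum_congr rfl fun ν _ => ?_
  simp only [PowerSeries.coeff_rescale, Finset.prod_mul_distrib, ← Finset.prod_pow_eq_pow_sum,
    pow_mul]
  rw [mul_comm]

theorem rotationProd_rescale (ω c : ℂ) (m : ℕ) (f : PowerSeries ℂ) :
    rotationProd ω m (PowerSeries.rescale c f) =
      PowerSeries.rescale c (rotationProd ω m f) := by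
  simp only [rotationProd, map_prod, PowerSeries.rescale_rescale, mul_comm c]

theorem tendsto_coeff_rotationProd {ι : Type*} {F : Filter ι} (ω : ℂ) (m : ℕ)
    {f : ι → PowerSeries ℂ} {g : PowerSeries ℂ}
    (h : ∀ l, Filter.Tendsto (fun t => PowerSeries.coeff l (f t)) F
      (nhds (PowerSeries.coeff l g))) (n : ℕ) :
    Filter.Tendsto (fun t => PowerSeries.coeff n (rotationProd ω m (f t))) F
      (nhds (PowerSeries.coeff n (rotationProd ω m g))) := by
  simp only [coeff_rotationProd]
  exact tendsto_finsetSum _ fun ν _ => (tendsto_finsetProd _ fun p _ => h _).mul_const _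

theorem prod_one_sub_primitiveRoot_mul {ω : ℂ} {m : ℕ} (hm : m ≠ 0) (hω : IsPrimitiveRoot ω m)
    (y : PowerSeries ℂ) :
    ∏ p : Fin m, (1 - PowerSeries.C (ω ^ (p : ℕ)) * y) = 1 - y ^ m := by
  have hC : IsPrimitiveRoot (PowerSeries.C ω) m := hω.map_of_injective PowerSeries.C_injective
  have : NeZero m := ⟨hm⟩
  rw [← one_pow (M := PowerSeries ℂ) m, hC.pow_sub_pow_eq_prod_sub_mul _ _ (Nat.pos_of_ne_zero hm),
    one_pow]
  refine Finset.prod_bij (fun p _ => PowerSeries.C ω ^ (p : ℕ)) ?_ ?_ ?_ ?_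
  · intro p _
    rw [Polynomial.mem_nthRootsFinset (Nat.pos_of_ne_zero hm), ← pow_mul, mul_comm, pow_mul,
      hC.pow_eq_one, one_pow]
  · intro p _ q _ h
    exact Fin.ext (hC.pow_inj p.2 q.2 h)
  · intro ζ hζ
    rw [Polynomial.mem_nthRootsFinset (Nat.pos_of_ne_zero hm)] at hζ
    obtain ⟨i, hi, rfl⟩ := hC.eq_pow_of_pow_eq_one hζ
    exact ⟨⟨i, hi⟩, Finset.mem_univ _, rfl⟩
  · intro p _
    rw [map_pow]

theorem rescale_C_eq {R : Type*} [CommSemiring R] (a c : R) :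
    PowerSeries.rescale a (PowerSeries.C c) = PowerSeries.C c := by
  ext n
  cases n <;> simp [PowerSeries.coeff_C]

/-- Each factor obeys `∏_p (1 - ω^p x X) = 1 - x^m X^m`. This carries the case of `r^(-2)` to that
of `r^(-2m)`. -/
theorem rotationProd_oneSubProd {ω : ℂ} {m : ℕ} (hm : m ≠ 0) (hω : IsPrimitiveRoot ω m)
    (x : ℕ → ℂ) (N : ℕ) :
    rotationProd ω m (oneSubProd x N) =
      PowerSeries.expand m hm (oneSubProd (fun r => x r ^ m) N) := by
  rw [oneSubProd, rotationProd_prod, oneSubProd, map_prod]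
  refine Finset.prod_congr rfl fun r _ => ?_
  rw [rotationProd, map_sub, map_mul, map_one, PowerSeries.expand_C, PowerSeries.expand_X,
    map_pow, ← mul_pow, ← prod_one_sub_primitiveRoot_mul hm hω]
  refine Finset.prod_congr rfl fun p _ => ?_
  rw [map_sub, map_mul, map_one, PowerSeries.rescale_X, rescale_C_eq]
  ring

theorem coeff_mul_expand {R : Type*} [CommRing R] {m : ℕ} (hm : m ≠ 0) (f g : PowerSeries R)
    (k : ℕ) :
    PowerSeries.coeff (m * k) (f * PowerSeries.expand m hm g) =
      ∑ ab ∈ Finset.HasAntidiagonal.antidiagonal k,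
        PowerSeries.coeff (m * ab.1) f * PowerSeries.coeff ab.2 g := by
  rw [PowerSeries.coeff_mul]
  symm
  refine Finset.sum_of_injOn (fun ab => (m * ab.1, m * ab.2)) ?_ ?_ ?_ ?_
  · rintro ⟨a, b⟩ _ ⟨c, d⟩ _ h
    simpa [hm] using h
  · rintro ⟨a, b⟩ h
    simp only [Finset.mem_coe, Finset.HasAntidiagonal.mem_antidiagonal] at h ⊢
    rw [← mul_add, h]
  · rintro ⟨u, v⟩ h hnot
    rw [Finset.HasAntidiagonal.mem_antidiagonal] at h
    simp only at h ⊢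
    rw [PowerSeries.coeff_expand_of_not_dvd, mul_zero]
    rintro ⟨b, rfl⟩
    obtain ⟨a, rfl⟩ : m ∣ u := (Nat.dvd_add_left (Dvd.intro b rfl)).mp (h ▸ Dvd.intro k rfl)
    refine hnot ⟨(a, b), ?_, rfl⟩
    rw [← mul_add] at h
    simpa using Nat.eq_of_mul_eq_mul_left (Nat.pos_of_ne_zero hm) h
  · rintro ⟨a, b⟩ _
    rw [PowerSeries.coeff_expand_mul]

/-! ### Evaluation of the even zeta sums -/

theorem isPrimitiveRoot_rhoRoot_sq {m : ℕ} (hm : m ≠ 0) : IsPrimitiveRoot (rhoRoot m ^ 2) m := by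
  have h : rhoRoot m ^ 2 = Complex.exp (2 * Real.pi * Complex.I / m) := by
    rw [rhoRoot, ← Complex.exp_nat_mul]
    congr 1
    push_cast
    ring
  rw [h]
  exact Complex.isPrimitiveRoot_exp m hm

/-- The sum of `ζ(2mk₁,…,2mkᵢ)` over the compositions `k = k₁ + ⋯ + kᵢ`. -/
noncomputable def evenZetaSum (m i k : ℕ) : ℂ :=
  sumCompositions i k fun l => (multipleZeta (l.map (2 * m * ·)) : ℂ)

theorem tendsto_coeff_compositionZetaSeries {m : ℕ} (hm : m ≠ 0) (i k : ℕ) :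
    Filter.Tendsto (fun N => PowerSeries.coeff k
      (compositionZetaSeries (fun r => (invSq r : ℂ) ^ m) N i)) Filter.atTop
      (nhds (evenZetaSum m i k)) := by
  simp only [compositionZetaSeries, PowerSeries.coeff_mk, evenZetaSum]
  refine tendsto_sumCompositions fun l _ hl => ?_
  have h := tendsto_truncatedZeta (l := l.map (2 * m * ·)) fun a ha => by
    obtain ⟨b, hb, rfl⟩ := List.mem_map.mp ha
    have h1 := hl b hb
    have h2 := Nat.pos_of_ne_zero hm
    have h3 : 1 ≤ m * b := Nat.mul_pos h2 h1
    rw [mul_assoc]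
    omega
  refine ((Complex.continuous_ofReal.tendsto _).comp h).congr fun N => ?_
  rw [Function.comp_apply, truncatedZeta_map_mul]
  refine (map_truncatedZeta Complex.ofRealHom _ N l).trans ?_
  congr 1
  funext r
  simp [invSq, pow_mul]

/-- Every truncated rotation product is a series in `X^m`, and this property survives the
coefficientwise limit. -/
theorem expand_mk_coeff_rotationProd {m : ℕ} (hm : m ≠ 0) {ω : ℂ} (hω : IsPrimitiveRoot ω m) :
    PowerSeries.expand m hm (PowerSeries.mk fun k => PowerSeries.coeff (m * k)
        (rotationProd ω m (PowerSeries.rescale (-(Real.pi : ℂ) ^ 2) sinhSeries))) =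
      rotationProd ω m (PowerSeries.rescale (-(Real.pi : ℂ) ^ 2) sinhSeries) ∧
    ∀ k, Filter.Tendsto (fun N => PowerSeries.coeff k
        (oneSubProd (fun r => (invSq r : ℂ) ^ m) N)) Filter.atTop
      (nhds (PowerSeries.coeff (m * k)
        (rotationProd ω m (PowerSeries.rescale (-(Real.pi : ℂ) ^ 2) sinhSeries)))) := by
  have hlim := tendsto_coeff_rotationProd ω m
    (f := oneSubProd (fun r => (invSq r : ℂ)))
    (g := PowerSeries.rescale (-(Real.pi : ℂ) ^ 2) sinhSeries) (F := Filter.atTop) fun l => by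
      simpa [sinhSeries, PowerSeries.coeff_rescale, div_eq_mul_inv] using
        tendsto_coeff_oneSubProd_invSq l
  simp only [rotationProd_oneSubProd hm hω] at hlim
  constructor
  · ext n
    by_cases hn : m ∣ n
    · obtain ⟨k, rfl⟩ := hn
      rw [PowerSeries.coeff_expand_mul, PowerSeries.coeff_mk]
    · rw [PowerSeries.coeff_expand_of_not_dvd _ _ _ hn]
      refine tendsto_nhds_unique ?_ (hlim n)
      simp only [PowerSeries.coeff_expand_of_not_dvd _ _ _ hn]
      exact tendsto_const_nhds
  · intro k
    refine (hlim (m * k)).congr fun N => ?_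
    rw [PowerSeries.coeff_expand_mul]

theorem evenZetaSum_eq {m : ℕ} (hm : m ≠ 0) {ω : ℂ} (hω : IsPrimitiveRoot ω m) (i k : ℕ) :
    evenZetaSum m i k =
      (∑ ab ∈ Finset.HasAntidiagonal.antidiagonal k, (ab.2.choose i : ℂ) *
        (PowerSeries.coeff (m * ab.1) (rotationProd ω m betaSeries) *
          PowerSeries.coeff (m * ab.2) (rotationProd ω m sinhSeries))) *
        (-1) ^ i * (-(Real.pi : ℂ) ^ 2) ^ (m * k) := by
  obtain ⟨hexp, hlim⟩ := expand_mk_coeff_rotationProd hm hω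
  set c : ℂ := -(Real.pi : ℂ) ^ 2
  set P := rotationProd ω m (PowerSeries.rescale c sinhSeries) with hP
  set A := rotationProd ω m (PowerSeries.rescale c betaSeries) with hA
  set b : PowerSeries ℂ := PowerSeries.mk fun k => PowerSeries.coeff (m * k) P
  have hAP : A * P = 1 := by
    rw [hA, hP, ← rotationProd_mul, ← map_mul, betaSeries_mul_sinhSeries, map_one,
      rotationProd_one]
  -- The truncated identity `D · F_i = (-X)^i D^(i) / i!` passes to the limit, since each
  -- coefficient of a product is a finite sum.
  have hZ : b * PowerSeries.mk (evenZetaSum m i) = signedHasseDeriv i b := by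
    ext n
    refine tendsto_nhds_unique (f := fun N => PowerSeries.coeff n
      (oneSubProd (fun r => (invSq r : ℂ) ^ m) N *
        compositionZetaSeries (fun r => (invSq r : ℂ) ^ m) N i)) (l := Filter.atTop) ?_ ?_
    · simp only [PowerSeries.coeff_mul]
      refine tendsto_finsetSum _ fun ab _ => Filter.Tendsto.mul ?_ ?_
      · simpa [b] using hlim ab.1
      · simpa using tendsto_coeff_compositionZetaSeries hm i ab.2
    · simp only [oneSubProd_mul_compositionZetaSeries, signedHasseDeriv, PowerSeries.coeff_mk]
      simpa [b] using (hlim n).const_mul ((-1) ^ i * (n.choose i : ℂ))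
  -- The inverse `A` of `P` is known only in the variable `X`, with `P = b(X^m)`, so the division
  -- takes place after `X ↦ X^m`.
  have hfin : PowerSeries.expand m hm (PowerSeries.mk (evenZetaSum m i)) =
      A * PowerSeries.expand m hm (signedHasseDeriv i b) := by
    rw [← hZ, map_mul, hexp, ← mul_assoc, hAP, one_mul]
  have hcoeff := congrArg (PowerSeries.coeff (m * k)) hfin
  rw [PowerSeries.coeff_expand_mul, PowerSeries.coeff_mk, coeff_mul_expand] at hcoeff
  rw [hcoeff, Finset.sum_mul, Finset.sum_mul]
  refine Finset.sum_congr rfl fun ab hab => ?_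
  rw [Finset.HasAntidiagonal.mem_antidiagonal] at hab
  rw [signedHasseDeriv, PowerSeries.coeff_mk, PowerSeries.coeff_mk, hA, hP,
    rotationProd_rescale, rotationProd_rescale, PowerSeries.coeff_rescale,
    PowerSeries.coeff_rescale, ← hab, mul_add m, pow_add]
  ring

/-! ### Assembling the formula -/

theorem coeff_rotationProd_betaSeries_mul_sinhSeries (m a b : ℕ) :
    PowerSeries.coeff a (rotationProd (rhoRoot m ^ 2) m betaSeries) *
        PowerSeries.coeff b (rotationProd (rhoRoot m ^ 2) m sinhSeries) =
      ∑ ν ∈ Finset.Nat.antidiagonalTuple m a, ∑ ℓ ∈ Finset.Nat.antidiagonalTuple m b,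
        (∏ p : Fin m, (betaEven (ν p) : ℂ) /
          ((Nat.factorial (2 * ν p) : ℂ) * (Nat.factorial (2 * ℓ p + 1) : ℂ))) *
        rhoRoot m ^ (∑ p : Fin m, 2 * (p : ℕ) * (ν p + ℓ p)) := by
  rw [coeff_rotationProd, coeff_rotationProd, Finset.sum_mul_sum]
  refine Finset.sum_congr rfl fun ν _ => Finset.sum_congr rfl fun ℓ _ => ?_
  have hexp : ∑ p : Fin m, 2 * (p : ℕ) * (ν p + ℓ p) =
      2 * ∑ p : Fin m, (p : ℕ) * ν p + 2 * ∑ p : Fin m, (p : ℕ) * ℓ p := by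
    rw [Finset.mul_sum, Finset.mul_sum, ← Finset.sum_add_distrib]
    exact Finset.sum_congr rfl fun p _ => by ring
  have hprod : ∏ p : Fin m, (betaEven (ν p) : ℂ) /
      ((Nat.factorial (2 * ν p) : ℂ) * (Nat.factorial (2 * ℓ p + 1) : ℂ)) =
      (∏ p, PowerSeries.coeff (ν p) betaSeries) * ∏ p, PowerSeries.coeff (ℓ p) sinhSeries := by
    rw [← Finset.prod_mul_distrib]
    refine Finset.prod_congr rfl fun p _ => ?_
    rw [betaSeries, sinhSeries, PowerSeries.coeff_mk, PowerSeries.coeff_mk, div_mul_div_comm,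
      mul_one]
  rw [hexp, hprod, pow_add, pow_mul, pow_mul]
  ring

theorem map_interpolatedMultipleZeta_map_mul (c : ℕ) (l : List ℕ) :
    (interpolatedMultipleZeta (l.map (c * ·))).map Complex.ofRealHom =
      ((boxIndices l).map fun p => (X : ℂ[X]) ^ (l.length - p.length) *
        C (multipleZeta (p.map (c * ·)) : ℂ)).sum := by
  rw [interpolatedMultipleZeta, ← Polynomial.coe_mapRingHom, map_list_sum, boxIndices_map_mul]
  simp [Function.comp_def]

theorem sum_interpolatedMultipleZeta (m n k : ℕ) (hn : 1 ≤ n) (hkn : n ≤ k) :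
    (∑ κ ∈ compositionsOfLength k n,
        (interpolatedMultipleZeta (List.ofFn (fun i => 2 * m * κ i))).map Complex.ofRealHom) =
      ∑ i ∈ Finset.Icc 1 n,
        C (evenZetaSum m i k * ((k - i).choose (k - n) : ℂ)) * (X : ℂ[X]) ^ (n - i) := by
  have hofFn : ∀ κ : Fin n → ℕ, List.ofFn (fun i => 2 * m * κ i) =
      (List.ofFn κ).map (2 * m * ·) := fun κ => by
    rw [List.map_ofFn]
    rfl
  simp only [hofFn]
  rw [sum_compositionsOfLength n k fun l =>
    (interpolatedMultipleZeta (l.map (2 * m * ·))).map Complex.ofRealHom]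
  have h : sumCompositions n k (fun l =>
      (interpolatedMultipleZeta (l.map (2 * m * ·))).map Complex.ofRealHom) =
      sumCompositions n k (fun l => ((boxIndices l).map fun p => (X : ℂ[X]) ^ (n - p.length) *
        C (multipleZeta (p.map (2 * m * ·)) : ℂ)).sum) :=
    sumCompositions_congr fun l hl _ => by rw [map_interpolatedMultipleZeta_map_mul, hl]
  rw [h, sumCompositions_boxIndices, Finset.sum_range_succ']
  -- The term `i = 0` drops out because `k ≥ 1`, so the sum starts at 1.
  have h0 : sumCompositions 0 k (fun p => (X : ℂ[X]) ^ (n - p.length) *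
      C (multipleZeta (p.map (2 * m * ·)) : ℂ)) = 0 := by
    obtain ⟨k, rfl⟩ := Nat.exists_eq_succ_of_ne_zero (by omega : k ≠ 0)
    exact sumCompositions_zero_succ _ _
  rw [h0, smul_zero, add_zero, Finset.range_eq_Ico,
    Finset.sum_Ico_add' (fun i => (k - i).choose (n - i) • sumCompositions i k fun p =>
      (X : ℂ[X]) ^ (n - p.length) * C (multipleZeta (p.map (2 * m * ·)) : ℂ)) 0 n 1, zero_add]
  refine Finset.sum_congr rfl fun i hi => ?_
  have hin : i ≤ n := Nat.lt_succ_iff.mp (Finset.mem_Ico.mp hi).2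
  -- Every index in this sum has depth `i`, so the power of `X` is constant and factors out.
  have hi' : sumCompositions i k (fun p => (X : ℂ[X]) ^ (n - p.length) *
      C (multipleZeta (p.map (2 * m * ·)) : ℂ)) = X ^ (n - i) * C (evenZetaSum m i k) := by
    rw [evenZetaSum]
    refine Eq.trans ?_ (map_sumCompositions
      ((AddMonoidHom.mulLeft ((X : ℂ[X]) ^ (n - i))).comp (C : ℂ →+* ℂ[X]).toAddMonoidHom) i k
      fun l => (multipleZeta (l.map (2 * m * ·)) : ℂ)).symm
    exact sumCompositions_congr fun l hl _ => by simp [hl]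
  have hchoose : (k - i).choose (n - i) = (k - i).choose (k - n) := by
    rw [← Nat.choose_symm (by omega : n - i ≤ k - i)]
    congr 1
    omega
  rw [hi', hchoose, nsmul_eq_mul, C_mul, map_natCast]
  ring

theorem lambdaConst_pow_div (k m : ℕ) :
    lambdaConst ^ (2 * k * m) / 4 ^ (k * m) = (-(Real.pi : ℂ) ^ 2) ^ (m * k) := by
  rw [mul_assoc, pow_mul, ← div_pow, mul_comm k m]
  congr 1
  rw [lambdaConst, mul_pow, mul_pow, Complex.I_sq]
  ring

theorem mainTheorem7 (k n m : ℕ) (hn : 1 ≤ n) (hkn : n ≤ k) (hm : 1 ≤ m) :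
    (∑ κ ∈ compositionsOfLength k n,
        (interpolatedMultipleZeta (List.ofFn (fun i => 2 * m * κ i))).map Complex.ofRealHom)
      = (∑ i ∈ Finset.Icc 1 n,
          C ((∑ j ∈ Finset.range (k - i + 1),
                (Nat.choose (k - j) i : ℂ) *
                  ∑ ν ∈ Finset.Nat.antidiagonalTuple m (m * j),
                    ∑ ℓ ∈ Finset.Nat.antidiagonalTuple m (m * (k - j)),
                      (∏ p : Fin m,
                        (betaEven (ν p) : ℂ) /
                          ((Nat.factorial (2 * ν p) : ℂ) * (Nat.factorial (2 * ℓ p + 1) : ℂ))) *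
                        rhoRoot m ^ (∑ p : Fin m, 2 * (p : ℕ) * (ν p + ℓ p)))
              * (-1) ^ i * (Nat.choose (k - i) (k - n) : ℂ)) * (X : ℂ[X]) ^ (n - i))
        * C (lambdaConst ^ (2 * k * m) / 4 ^ (k * m)) := by
  have hm0 : m ≠ 0 := Nat.one_le_iff_ne_zero.mp hm
  rw [sum_interpolatedMultipleZeta m n k hn hkn, Finset.sum_mul]
  refine Finset.sum_congr rfl fun i hi => ?_
  rw [Finset.mem_Icc] at hi
  rw [mul_right_comm, ← C_mul, lambdaConst_pow_div,
    evenZetaSum_eq hm0 (isPrimitiveRoot_rhoRoot_sq hm0),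
    Finset.Nat.sum_antidiagonal_eq_sum_range_succ_mk]
  simp only [coeff_rotationProd_betaSeries_mul_sinhSeries]
  -- The convolution runs over `j ≤ k`; for `j > k - i` the factor `(k - j).choose i` is 0.
  rw [← Finset.sum_subset (Finset.range_subset_range.mpr (by omega : k - i + 1 ≤ k + 1))]
  · congr 2
    ring
  · intro j _ hj
    rw [Finset.mem_range] at hj
    rw [Nat.choose_eq_zero_of_lt (by omega), Nat.cast_zero, zero_mul]
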